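/- Let $r\ge 0$, let $S=\mathbb N^r\setminus\{0\}$, and let $\langle-,-\rangle$ be a skew-symmetric bilinear form on $\mathbb Z^r$ with real (for example integer) values. Let $\mathcal R=\bigoplus_{\gamma\in\mathbb N^r}\mathcal R_\gamma$ be a graded associative $\mathbb Q$-algebra such that $\langle\gamma,\gamma'\rangle=0$ implies $[\mathcal R_\gamma,\mathcal R_{\gamma'}]=0$, and let $A:S\to\mathcal R$ be a map with $A(\gamma)\in\mathcal R_\gamma$ for all $\gamma\in S$. For $\theta\in\mathbb R^r$ and $a\in S$ put $\mu_\theta(a)=\frac{\sum_k\theta_ka_k}{\sum_ka_k}$. Write $a>_\theta b$ if $\mu_\theta(a)>\mu_\theta(b)$ and $a\sim_\theta b$ if $\mu_\theta(a)=\mu_\theta(b)$. Call $\theta$ generic if $a\sim_\theta b$ (with $a,b\in S$) implies $ma=nb$ for some integers $m,n\ge1$. Define $A_\theta:S\to\mathcal R$ recursively by $$A(\gamma)=\sum_{\substack{n\ge1,\ \alpha\in S^n\\ \alpha_1+\dots+\alpha_n=\gamma\\ \alpha_1>_\theta\dots>_\theta\alpha_n}}A_\theta(\alpha_1)\cdots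 A_\theta(\alpha_n),\qquad\gamma\in S,$$ and define the rational DT invariants $\bar A_\theta:S\to\mathcal R$ by $$\bar A_\theta(\gamma)=\sum_{\substack{n\ge1,\ \alpha\in S^n\\ \alpha_1+\dots+\alpha_n=\gamma\\ \alpha_1\sim_\theta\dots\sim_\theta\alpha_n}}\frac{(-1)^{n-1}}{n}\,A_\theta(\alpha_1)\cdots A_\theta(\alpha_n),\qquad\gamma\in S.$$ Let $\gamma\in S$ and let $\theta=\langle-,\gamma\rangle$, that is $\theta_k=\langle e_k,\gamma\rangle$ (this $\theta$ need not be generic). The rational attractor invariant $\bar A_*(\gamma)$ is the common value of $\bar A_{\theta'}(\gamma)$ for all generic $\theta'\in\mathbb R^r$ sufficiently close to $\theta$ (how close may depend on $\gamma$ and $A$; generic $\theta'$ are dense in $\mathbb R^r$). Then $\bar A_*(\gamma)$ is well defined, and $$\bar A_*(\gamma)=\bar A_\theta(\gamma).$$ -/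

import Mathlib

open Filter Topology

/-- The semigroup `S = ℕ^r ∖ {0}`. -/
abbrev DimVec (r : ℕ) : Type := {γ : Fin r → ℕ // γ ≠ 0}

namespace DimVec

variable {r : ℕ}

/-- The total dimension `∑ₖ aₖ`, which is positive on `S`. -/
def size (a : DimVec r) : ℕ := ∑ k, a.1 k

/-- The sum `α₁ + ⋯ + αₙ` of a tuple of elements of `S`, in `ℕ^r` (zero for the empty tuple). -/
def total (α : List (DimVec r)) : Fin r → ℕ := (α.map Subtype.val).sum

/-- `γ` regarded as an element of the lattice `ℤ^r`. -/
def toLattice (γ : Fin r → ℕ) : Fin r → ℤ := fun k => (γ k : ℤ)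

/-- Proportionality `a ∥ b`: `m a = n b` for some `m, n ≥ 1`. -/
def Proportional (a b : DimVec r) : Prop :=
  ∃ m n : ℕ, 1 ≤ m ∧ 1 ≤ n ∧ m • a.1 = n • b.1

theorem size_pos (a : DimVec r) : 0 < a.size := by
  by_contra h
  apply a.2
  funext k
  have h0 : ∑ k, a.1 k = 0 := by simpa [size] using h
  exact (Finset.sum_eq_zero_iff.mp h0) k (Finset.mem_univ k)

theorem sum_total (α : List (DimVec r)) : ∑ k, total α k = (α.map size).sum := by
  induction α with
  | nil => simp [total]
  | cons a l ih =>
    have h : total (a :: l) = a.1 + total l := by simp [total]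
    rw [h]
    simp [Finset.sum_add_distrib, ih, size]

theorem le_total {α : List (DimVec r)} {a : DimVec r} (h : a ∈ α) : a.1 ≤ total α :=
  List.single_le_sum (fun _ _ => zero_le) _ (List.mem_map_of_mem h)

theorem length_le (α : List (DimVec r)) : α.length ≤ (α.map size).sum := by
  induction α with
  | nil => simp
  | cons a l ih =>
    have := a.size_pos
    simp only [List.length_cons, List.map_cons, List.sum_cons]
    omega

/-- Every element of `S` is a sum of elements of `S` in only finitely many ways. -/
theorem finite_total (γ : Fin r → ℕ) : {α : List (DimVec r) | total α = γ}.Finite := by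
  have hT : {a : DimVec r | a.1 ≤ γ}.Finite :=
    Set.Finite.preimage (f := Subtype.val) (Subtype.val_injective.injOn) (Set.finite_Iic γ)
  have : Finite {a : DimVec r // a.1 ≤ γ} := hT
  refine ((List.finite_length_le {a : DimVec r // a.1 ≤ γ} (∑ k, γ k)).image
    (List.map Subtype.val)).subset ?_
  rintro α rfl
  refine ⟨α.attach.map (fun a => ⟨a.1, le_total a.2⟩), ?_, ?_⟩
  · simp only [Set.mem_ofPred_eq, List.length_map, List.length_attach]
    rw [sum_total]
    exact length_le α
  · simpa [List.map_map, Function.comp_def] using List.attach_map_subtype_val α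

/-- The finite set of tuples `(α₁, …, αₙ) ∈ Sⁿ`, `n ≥ 1`, with `α₁ + ⋯ + αₙ = γ`. -/
noncomputable def decomp (γ : DimVec r) : Finset (List (DimVec r)) :=
  (finite_total γ.1).toFinset

theorem mem_decomp {γ : DimVec r} {α : List (DimVec r)} : α ∈ decomp γ ↔ total α = γ.1 := by
  simp [decomp]

theorem sum_size_of_mem_decomp {γ : DimVec r} {α : List (DimVec r)} (h : α ∈ decomp γ) :
    (α.map size).sum = γ.size := by
  rw [← sum_total, mem_decomp.mp h, size]

/-- In a decomposition into at least two elements of `S`, every element is strictly smaller. -/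
theorem size_lt_of_mem {γ : DimVec r} {α : List (DimVec r)} (h : α ∈ decomp γ)
    (h2 : 2 ≤ α.length) {a : DimVec r} (ha : a ∈ α) : a.size < γ.size := by
  obtain ⟨l₁, l₂, rfl⟩ := List.append_of_mem ha
  have h3 := sum_size_of_mem_decomp h
  have h4 := length_le l₁
  have h5 := length_le l₂
  simp only [List.map_append, List.map_cons, List.sum_append, List.sum_cons,
    List.length_append, List.length_cons] at h3 h2
  omega

theorem singleton_mem_decomp (γ : DimVec r) : [γ] ∈ decomp γ := by
  simp [mem_decomp, total]

theorem eq_singleton {γ : DimVec r} {α : List (DimVec r)} (h : α ∈ decomp γ)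
    (h2 : ¬ 2 ≤ α.length) : α = [γ] := by
  match α, h2 with
  | [], _ => exact absurd (mem_decomp.mp h).symm (by simpa [total] using γ.2)
  | [a], _ =>
    have h' := mem_decomp.mp h
    simp only [total, List.map_cons, List.map_nil, List.sum_cons, List.sum_nil, add_zero] at h'
    rw [Subtype.ext h']
  | _ :: _ :: _, h2 => simp at h2

/-- The slope `μ_θ(a) = (∑ₖ θₖ aₖ) / (∑ₖ aₖ)`.  The weak stability on `S` defined by `θ` is
`a ≤_θ b ↔ slope θ a ≤ slope θ b`. -/
noncomputable def slope (θ : Fin r → ℝ) (a : DimVec r) : ℝ :=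
  (∑ k, θ k * (a.1 k : ℝ)) / (a.size : ℝ)

/-- `θ` is generic if `a ∼_θ b` implies `a ∥ b`. -/
def IsGeneric (θ : Fin r → ℝ) : Prop :=
  ∀ a b : DimVec r, slope θ a = slope θ b → Proportional a b

/-- Generic stability parameters are dense, so every `θ` has arbitrarily small generic
perturbations. -/
theorem dense_isGeneric : Dense {θ : Fin r → ℝ | IsGeneric θ} := by
  have hset : {θ : Fin r → ℝ | IsGeneric θ} =
      ⋂ p : {p : DimVec r × DimVec r // ¬ Proportional p.1 p.2},
        {θ | slope θ p.1.1 ≠ slope θ p.1.2} := by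
    ext θ
    rw [Set.mem_iInter]
    exact ⟨fun h p he => p.2 (h p.1.1 p.1.2 he), fun h a b he => by
      by_contra hp
      exact h ⟨(a, b), hp⟩ he⟩
  have hcont : ∀ a : DimVec r, Continuous fun θ : Fin r → ℝ => slope θ a := by
    intro a
    unfold slope
    fun_prop
  rw [hset]
  refine dense_iInter_of_isOpen (fun p => isOpen_ne_fun (hcont _) (hcont _)) ?_
  rintro ⟨⟨a, b⟩, hp⟩
  -- some coordinate direction separates the slopes of `a` and `b`
  obtain ⟨k, hk⟩ : ∃ k, (a.1 k : ℝ) / a.size ≠ (b.1 k : ℝ) / b.size := by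
    by_contra! hall
    refine hp ⟨b.size, a.size, b.size_pos, a.size_pos, ?_⟩
    funext k
    have ha : (a.size : ℝ) ≠ 0 := by exact_mod_cast a.size_pos.ne'
    have hb : (b.size : ℝ) ≠ 0 := by exact_mod_cast b.size_pos.ne'
    have h := (div_eq_div_iff ha hb).mp (hall k)
    have h' : a.1 k * b.size = b.1 k * a.size := by exact_mod_cast h
    simp only [Pi.smul_apply, smul_eq_mul]
    rw [mul_comm, h', mul_comm]
  have hadd : ∀ (c : DimVec r) (θ : Fin r → ℝ) (t : ℝ),
      slope (θ + t • Pi.single k 1) c = slope θ c + t * ((c.1 k : ℝ) / c.size) := by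
    intro c θ t
    simp only [slope, Pi.add_apply, Pi.smul_apply, smul_eq_mul, add_mul, Finset.sum_add_distrib,
      add_div]
    congr 1
    rw [Finset.sum_eq_single k]
    · simp [mul_div_assoc]
    · intro j _ hj
      simp [Pi.single_eq_of_ne hj]
    · simp
  intro θ
  by_cases hθ : slope θ a = slope θ b
  · have hpath : Tendsto (fun t : ℝ => θ + t • (Pi.single k 1 : Fin r → ℝ)) (𝓝[≠] 0) (𝓝 θ) := by
      have hc : Continuous fun t : ℝ => θ + t • (Pi.single k 1 : Fin r → ℝ) := by fun_prop
      have := (hc.tendsto 0).mono_left (nhdsWithin_le_nhds (s := {0}ᶜ))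
      simpa using this
    refine mem_closure_of_tendsto hpath ?_
    filter_upwards [self_mem_nhdsWithin] with t ht
    simp only [hadd, hθ, ne_eq, add_right_inj]
    exact fun h => hk (mul_left_cancel₀ ht h)
  · exact subset_closure hθ

section Collections

variable {R : Type*} [Ring R] [Algebra ℚ R]

/-- The action of a rational collection on a 1-collection:
`(F * H)(γ) = ∑_{α₁ + ⋯ + αₙ = γ} F(α) H(α₁) ⋯ H(αₙ)`. -/
noncomputable def act (F : List (DimVec r) → ℚ) (H : DimVec r → R) : DimVec r → R :=
  fun γ => ∑ α ∈ decomp γ, F α • (α.map H).prod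

open Classical in
/-- The Harder-Narasimhan collection `s_θ`: it is `1` if `α₁ >_θ ⋯ >_θ αₙ` and `0` otherwise. -/
noncomputable def hnCol (θ : Fin r → ℝ) (α : List (DimVec r)) : ℚ :=
  if α.Pairwise (fun a b => slope θ b < slope θ a) then 1 else 0

open Classical in
/-- The logarithmic collection `log_θ`: it is `(-1)^(n-1) / n` if `α₁ ∼_θ ⋯ ∼_θ αₙ` and `0`
otherwise. -/
noncomputable def logCol (θ : Fin r → ℝ) (α : List (DimVec r)) : ℚ :=
  if α.Pairwise (fun a b => slope θ a = slope θ b) then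
    (-1) ^ (α.length - 1) / (α.length : ℚ)
  else 0

/-- The stacky DT invariants `A_θ` of a 1-collection `A`, defined recursively by the basic
wall-crossing formula `A(γ) = ∑ A_θ(α₁) ⋯ A_θ(αₙ)`, the sum over all `α₁ + ⋯ + αₙ = γ` with
`α₁ >_θ ⋯ >_θ αₙ`: the summand with `n = 1` is `A_θ(γ)`, and the other ones are subtracted.
See `hnCol_act_stackyDT` and `stackyDT_unique`. -/
noncomputable def stackyDT (A : DimVec r → R) (θ : Fin r → ℝ) (γ : DimVec r) : R :=
  A γ - ∑ α ∈ ((decomp γ).filter (fun α => 2 ≤ α.length)).attach,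
    hnCol θ α.1 • (α.1.attach.map (fun a => stackyDT A θ a.1)).prod
termination_by γ.size
decreasing_by
  have h := Finset.mem_filter.mp α.2
  exact size_lt_of_mem h.1 h.2 a.2

theorem act_hnCol_eq (θ : Fin r → ℝ) (B : DimVec r → R) (γ : DimVec r) :
    act (hnCol θ) B γ = B γ +
      ∑ α ∈ (decomp γ).filter (fun α => 2 ≤ α.length), hnCol θ α • (α.map B).prod := by
  classical
  have h : (decomp γ).filter (fun α => ¬ 2 ≤ α.length) = {[γ]} := by
    ext α
    simp only [Finset.mem_filter, Finset.mem_singleton]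
    constructor
    · rintro ⟨h1, h2⟩
      exact eq_singleton h1 h2
    · rintro rfl
      exact ⟨singleton_mem_decomp γ, by simp⟩
  rw [act, ← Finset.sum_filter_add_sum_filter_not _ (fun α => 2 ≤ α.length), h, add_comm]
  simp [hnCol]

/-- The basic wall-crossing formula `A = s_θ * A_θ`. -/
theorem hnCol_act_stackyDT (A : DimVec r → R) (θ : Fin r → ℝ) :
    act (hnCol θ) (stackyDT A θ) = A := by
  funext γ
  rw [act_hnCol_eq, stackyDT]
  have h : ∀ α : List (DimVec r),
      α.attach.map (fun a => stackyDT A θ a.1) = α.map (stackyDT A θ) := fun α => by simp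
  simp only [h]
  rw [Finset.sum_attach ((decomp γ).filter (fun α => 2 ≤ α.length))
    (fun α => hnCol θ α • (α.map (stackyDT A θ)).prod)]
  abel

/-- The basic wall-crossing formula determines `A_θ`. -/
theorem stackyDT_unique (A B : DimVec r → R) (θ : Fin r → ℝ) (h : act (hnCol θ) B = A) :
    B = stackyDT A θ := by
  have key : ∀ n : ℕ, ∀ γ : DimVec r, γ.size < n → B γ = stackyDT A θ γ := by
    intro n
    induction n with
    | zero => intro γ hγ; omega
    | succ n ih =>
      intro γ hγ
      have h1 := congrFun (h.trans (hnCol_act_stackyDT A θ).symm) γ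
      rw [act_hnCol_eq, act_hnCol_eq] at h1
      have h2 : ∑ α ∈ (decomp γ).filter (fun α => 2 ≤ α.length), hnCol θ α • (α.map B).prod =
          ∑ α ∈ (decomp γ).filter (fun α => 2 ≤ α.length),
            hnCol θ α • (α.map (stackyDT A θ)).prod := by
        refine Finset.sum_congr rfl fun α hα => ?_
        have hα' := Finset.mem_filter.mp hα
        rw [List.map_congr_left fun a ha => ih a (by
          have := size_lt_of_mem hα'.1 hα'.2 ha
          omega)]
      rw [h2] at h1
      exact add_right_cancel h1
  funext γ
  exact key _ γ (Nat.lt_succ_self _)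

/-- The rational DT invariants `Ā_θ = log_θ * A_θ`. -/
noncomputable def rationalDT (A : DimVec r → R) (θ : Fin r → ℝ) : DimVec r → R :=
  act (logCol θ) (stackyDT A θ)

/-- The self-stability `θ = ⟨-, γ⟩`, in coordinates `θₖ = ⟨eₖ, γ⟩`. -/
def selfStability (ω : (Fin r → ℤ) →ₗ[ℤ] (Fin r → ℤ) →ₗ[ℤ] ℝ) (γ : DimVec r) : Fin r → ℝ :=
  fun k => ω (Pi.single k 1) (toLattice γ.1)

/-- `x` is the value `Ā_θ'(γ)` for all sufficiently small generic perturbations `θ'` of the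
self-stability `θ = ⟨-, γ⟩`. -/
def IsAttractorInvariant (A : DimVec r → R) (ω : (Fin r → ℤ) →ₗ[ℤ] (Fin r → ℤ) →ₗ[ℤ] ℝ)
    (γ : DimVec r) (x : R) : Prop :=
  ∀ᶠ θ' in 𝓝 (selfStability ω γ), IsGeneric θ' → rationalDT A θ' γ = x

theorem IsAttractorInvariant.unique {A : DimVec r → R}
    {ω : (Fin r → ℤ) →ₗ[ℤ] (Fin r → ℤ) →ₗ[ℤ] ℝ} {γ : DimVec r} {x y : R}
    (hx : IsAttractorInvariant A ω γ x) (hy : IsAttractorInvariant A ω γ y) : x = y := by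
  have hf : ∃ᶠ θ' in 𝓝 (selfStability ω γ), IsGeneric θ' :=
    mem_closure_iff_frequently.mp (dense_isGeneric _)
  obtain ⟨θ', hg, h1, h2⟩ := (hf.and_eventually (Filter.Eventually.and hx hy)).exists
  exact (h1 hg).symm.trans (h2 hg)

open Classical in
/-- The attractor invariant `Ā_*(γ) = Ā_θ'(γ)`, for a sufficiently small generic perturbation
`θ'` of the self-stability `θ = ⟨-, γ⟩`.  It is the unique `x` with `IsAttractorInvariant A ω γ x`;
the value `0` is a placeholder in case `Ā_θ'(γ)` depends on the choice of `θ'`. -/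
noncomputable def attractorInvariant (A : DimVec r → R)
    (ω : (Fin r → ℤ) →ₗ[ℤ] (Fin r → ℤ) →ₗ[ℤ] ℝ) (γ : DimVec r) : R :=
  if h : ∃ x, IsAttractorInvariant A ω γ x then h.choose else 0

end Collections

end DimVec

/-! For fixed `γ` only the finitely many elements `≤ γ` matter, and any `θ'` close to `θ = ⟨-, γ⟩`
refines the order of their `θ`-slopes (`eventually_refinesBelow`). By uniqueness of
Harder-Narasimhan recursions, the series `1 + ∑ A_θ(b) t^b` over one `θ`-slope is then, in degrees
`≤ γ`, the decreasing product of the analogous series over the `θ'`-slopes above it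
(`stackyDT_eq_refinedDT`).

The rational invariants are coefficients of logarithms of these series, so the logarithm of an
ordered product has to be compared with the sum of the logarithms. Skew-symmetry gives `γ` slope
`0`, so the relevant degrees `a` satisfy `⟨a, γ⟩ = 0`. If `a + b = γ` as well, then `⟨a, b⟩ = ⟨a, γ⟩
- ⟨a, a⟩ = 0`, and the two graded pieces commute. Hence the coefficient at `γ` is a trace on the
ring of slope-zero series (`coeff_mul_comm_of_homogeneous`).

Under a trace, `x⁻¹ D(x)`, with `D` the Euler derivation, is additive on products
(`coeff_logDeriv_mul`) and computes `D(log x)` (`degree_smul_coeff_log`). In degree `γ` only the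
factor of the `θ'`-slope of `γ` contributes, and dividing by the size of `γ` gives the equality. -/

namespace DimVec

variable {r : ℕ} {R : Type*} [Ring R]

/-! ### Generating series of sums over tuples -/

open Classical in
/-- The generating series `∑ H(b) t^b` over the `b ∈ S` with `p b`. -/
noncomputable def classSeries (p : DimVec r → Prop) (H : DimVec r → R) :
    MvPowerSeries (Fin r) R :=
  fun β => if h : (⇑β : Fin r → ℕ) ≠ 0 then (if p ⟨β, h⟩ then H ⟨β, h⟩ else 0) else 0

open Classical in
theorem coeff_classSeries (p : DimVec r → Prop) (H : DimVec r → R) (γ : DimVec r) :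
    MvPowerSeries.coeff (Finsupp.equivFunOnFinite.symm γ.1) (classSeries p H) =
      if p γ then H γ else 0 :=
  dif_pos (show (⇑(Finsupp.equivFunOnFinite.symm γ.1) : Fin r → ℕ) ≠ 0 from γ.2)

theorem coeff_zero_classSeries (p : DimVec r → Prop) (H : DimVec r → R) :
    MvPowerSeries.coeff 0 (classSeries p H) = 0 :=
  dif_neg (by simp)

/-- The series `1 + ∑ H(b) t^b` over the `b ∈ S` of slope `s`. -/
noncomputable def slopeFactor (θ : Fin r → ℝ) (H : DimVec r → R) (s : ℝ) :
    MvPowerSeries (Fin r) R :=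
  1 + classSeries (fun b => slope θ b = s) H

theorem coeff_zero_slopeFactor (θ : Fin r → ℝ) (H : DimVec r → R) (s : ℝ) :
    MvPowerSeries.coeff 0 (slopeFactor θ H s) = 1 := by
  rw [slopeFactor, map_add, coeff_zero_classSeries, add_zero, MvPowerSeries.coeff_zero_one]

/-- Case distinction on exponents: the zero exponent, and the elements of `S`. -/
theorem exponent_cases {P : (Fin r →₀ ℕ) → Prop} (h0 : P 0)
    (h : ∀ γ : DimVec r, P (Finsupp.equivFunOnFinite.symm γ.1)) (β : Fin r →₀ ℕ) : P β := by
  by_cases hβ : (⇑β : Fin r → ℕ) = 0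
  · have : β = 0 := DFunLike.coe_injective (by simpa using hβ)
    rwa [this]
  · simpa using h ⟨β, hβ⟩

theorem slopeFactor_eq_of_coeff {θ : Fin r → ℝ} {H : DimVec r → R} {s : ℝ}
    {G : MvPowerSeries (Fin r) R} (h0 : MvPowerSeries.coeff 0 G = 1)
    (h1 : ∀ β : DimVec r, slope θ β ≠ s →
      MvPowerSeries.coeff (Finsupp.equivFunOnFinite.symm β.1) G = 0)
    (h2 : ∀ β : DimVec r, slope θ β = s →
      MvPowerSeries.coeff (Finsupp.equivFunOnFinite.symm β.1) G = H β) :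
    slopeFactor θ H s = G := by
  classical
  ext β
  induction β using exponent_cases with
  | h0 => rw [coeff_zero_slopeFactor, h0]
  | h γ =>
    have h3 : Finsupp.equivFunOnFinite.symm γ.1 ≠ 0 := fun h => γ.2 (by
      simpa using congrArg (⇑· : (Fin r →₀ ℕ) → Fin r → ℕ) h)
    rw [slopeFactor, map_add, coeff_classSeries, MvPowerSeries.coeff_one, if_neg h3, zero_add]
    split_ifs with h
    · exact (h2 γ h).symm
    · exact (h1 γ h).symm

variable [Algebra ℚ R]

/-- The generating series of `β ↦ ∑_{α₁ + ⋯ + αₙ = β} F(α) H(α₁) ⋯ H(αₙ)`, where `n = 0` is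
allowed. -/
noncomputable def genSeries (F : List (DimVec r) → ℚ) (H : DimVec r → R) :
    MvPowerSeries (Fin r) R :=
  fun β => ∑ α ∈ (finite_total ⇑β).toFinset, F α • (α.map H).prod

open Classical in
/-- The collection which is `F(α₂, …, αₙ)` if `n ≥ 1` and `p α₁`, and `0` otherwise. -/
noncomputable def consCol (p : DimVec r → Prop) (F : List (DimVec r) → ℚ) :
    List (DimVec r) → ℚ
  | [] => 0
  | b :: α => if p b then F α else 0

theorem coeff_genSeries (F : List (DimVec r) → ℚ) (H : DimVec r → R) (β : Fin r →₀ ℕ) :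
    MvPowerSeries.coeff β (genSeries F H) =
      ∑ α ∈ (finite_total ⇑β).toFinset, F α • (α.map H).prod := rfl

theorem coeff_genSeries_eq_act (F : List (DimVec r) → ℚ) (H : DimVec r → R) (γ : DimVec r) :
    MvPowerSeries.coeff (Finsupp.equivFunOnFinite.symm γ.1) (genSeries F H) = act F H γ := rfl

theorem total_cons (b : DimVec r) (α : List (DimVec r)) : total (b :: α) = b.1 + total α := by
  simp [total]

theorem total_eq_zero {α : List (DimVec r)} : total α = 0 ↔ α = [] := by
  refine ⟨fun h => ?_, by rintro rfl; simp [total]⟩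
  have h1 := sum_total α
  have h2 := length_le α
  rw [h] at h1
  simp only [Pi.zero_apply, Finset.sum_const_zero] at h1
  exact List.length_eq_zero_iff.mp (by omega)

theorem genSeries_add (F G : List (DimVec r) → ℚ) (H : DimVec r → R) :
    genSeries (F + G) H = genSeries F H + genSeries G H := by
  ext β
  simp [coeff_genSeries, add_smul, Finset.sum_add_distrib]

theorem coeff_zero_genSeries (F : List (DimVec r) → ℚ) (H : DimVec r → R) :
    MvPowerSeries.coeff 0 (genSeries F H) = F [] • (1 : R) := by
  have : (finite_total ⇑(0 : Fin r →₀ ℕ)).toFinset = {([] : List (DimVec r))} := by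
    ext α
    simp [total_eq_zero]
  simp [coeff_genSeries, this]

theorem genSeries_nil [DecidableEq (List (DimVec r))] (H : DimVec r → R) :
    genSeries (fun α => if α = [] then 1 else 0) H = 1 := by
  classical
  ext β
  rw [MvPowerSeries.coeff_one]
  induction β using exponent_cases with
  | h0 => simp [coeff_zero_genSeries]
  | h γ =>
    have h1 : Finsupp.equivFunOnFinite.symm γ.1 ≠ 0 := fun h => γ.2 (by
      simpa using congrArg (⇑· : (Fin r →₀ ℕ) → Fin r → ℕ) h)
    rw [if_neg h1, coeff_genSeries_eq_act, act]
    refine Finset.sum_eq_zero fun α hα => ?_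
    rw [if_neg, zero_smul]
    rintro rfl
    exact γ.2 ((mem_decomp.mp hα).symm.trans (by simp [total]))

/-- A nonempty tuple is the same as its first entry together with its tail. -/
theorem classSeries_mul_genSeries (p : DimVec r → Prop) (F : List (DimVec r) → ℚ)
    (H : DimVec r → R) : classSeries p H * genSeries F H = genSeries (consCol p F) H := by
  classical
  ext β
  rw [MvPowerSeries.coeff_mul, coeff_genSeries]
  -- This set has at most one element and is empty for `a = 0`, so summing over it treats the zero
  -- exponent uniformly.
  have hb : ∀ a : Fin r →₀ ℕ, {b : DimVec r | b.1 = a}.Finite := fun a =>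
    Set.Subsingleton.finite fun x hx y hy => Subtype.ext (hx.trans hy.symm)
  have hc : ∀ a : Fin r →₀ ℕ, MvPowerSeries.coeff a (classSeries p H) =
      ∑ b ∈ (hb a).toFinset, if p b then H b else 0 := by
    intro a
    induction a using exponent_cases with
    | h0 =>
      rw [coeff_zero_classSeries, Finset.sum_eq_zero]
      intro b h
      exact absurd (by simpa using h) b.2
    | h γ =>
      have : (hb (Finsupp.equivFunOnFinite.symm γ.1)).toFinset = {γ} := by
        ext b
        simp [Subtype.ext_iff]
      rw [coeff_classSeries, this, Finset.sum_singleton]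
  simp_rw [hc, coeff_genSeries, Finset.sum_mul_sum]
  simp_rw [← Finset.sum_product']
  rw [Finset.sum_sigma']
  refine Finset.sum_of_injOn (fun x => x.2.1 :: x.2.2) ?_ ?_ ?_ ?_
  · rintro ⟨⟨a, c⟩, b, α⟩ h ⟨⟨a', c'⟩, b', α'⟩ h' he
    simp at h h' he
    obtain ⟨-, hba, hac⟩ := h
    obtain ⟨-, hba', hac'⟩ := h'
    obtain ⟨rfl, rfl⟩ := he
    obtain rfl : a = a' := DFunLike.coe_injective (hba.symm.trans hba')
    obtain rfl : c = c' := DFunLike.coe_injective (hac.symm.trans hac')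
    rfl
  · rintro ⟨⟨a, c⟩, b, α⟩ h
    simp at h ⊢
    obtain ⟨rfl, hba, hac⟩ := h
    rw [total_cons, hba, hac]
    rfl
  · intro α hα hn
    match α with
    | [] => simp [consCol]
    | b :: α =>
      exfalso
      refine hn ⟨⟨(Finsupp.equivFunOnFinite.symm b.1, Finsupp.equivFunOnFinite.symm (total α)),
        b, α⟩, ?_, rfl⟩
      have h : total (b :: α) = β := by simpa using hα
      rw [total_cons] at h
      simp
      exact DFunLike.coe_injective (by rw [← h]; rfl)
  · rintro ⟨⟨a, c⟩, b, α⟩ h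
    by_cases hp : p b <;> simp [consCol, hp]

/-! ### Ordered products over slopes -/

open Classical in
/-- The Harder-Narasimhan collection with slopes in `L`, with value `1` on the empty tuple. -/
noncomputable def hnColIn (θ : Fin r → ℝ) (L : List ℝ) (α : List (DimVec r)) : ℚ :=
  if α.Pairwise (fun a b => slope θ b < slope θ a) ∧ ∀ a ∈ α, slope θ a ∈ L then 1 else 0

/-- The head `s` exceeds all other slopes in the list, so a decreasing tuple has at most one entry
of slope `s`, necessarily the first. The two summands of the leading factor account for its absence
and presence. -/
theorem prod_slopeFactor (θ : Fin r → ℝ) (H : DimVec r → R) {L : List ℝ}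
    (hL : L.Pairwise (· > ·)) :
    (L.map (slopeFactor θ H)).prod = genSeries (hnColIn θ L) H := by
  classical
  induction L with
  | nil =>
    rw [List.map_nil, List.prod_nil, ← genSeries_nil H]
    congr 1
    funext α
    cases α with
    | nil => simp [hnColIn]
    | cons b α =>
      rw [if_neg (List.cons_ne_nil b α), hnColIn,
        if_neg fun h => List.not_mem_nil (h.2 b List.mem_cons_self)]
  | cons s L ih =>
    obtain ⟨hs, hL⟩ := List.pairwise_cons.mp hL
    rw [List.map_cons, List.prod_cons, ih hL, slopeFactor, add_mul, one_mul,
      classSeries_mul_genSeries, ← genSeries_add]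
    congr 1
    funext α
    match α with
    | [] => simp [hnColIn, consCol]
    | b :: α =>
      simp only [Pi.add_apply, consCol, hnColIn]
      have hsL : s ∉ L := fun h => lt_irrefl _ (hs s h)
      by_cases hb : slope θ b = s
      · have h1 : ¬ ∀ a ∈ b :: α, slope θ a ∈ L := fun h =>
          hsL (hb ▸ h b List.mem_cons_self)
        rw [if_neg (fun h => h1 h.2), if_pos hb, zero_add]
        refine if_congr (Iff.symm ?_) rfl rfl
        simp only [List.pairwise_cons, List.forall_mem_cons]
        simp only [List.mem_cons, hb, true_or, true_and]
        constructor
        · rintro ⟨h, h'⟩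
          exact ⟨h.2, fun a ha => (h' a ha).resolve_left (h.1 a ha).ne⟩
        · rintro ⟨h, h'⟩
          exact ⟨⟨fun a ha => hs _ (h' a ha), h⟩, fun a ha => .inr (h' a ha)⟩
      · rw [if_neg hb, add_zero]
        refine if_congr (Iff.symm ?_) rfl rfl
        simp only [List.pairwise_cons, List.forall_mem_cons]
        simp only [List.mem_cons, hb, false_or]
        constructor
        · rintro ⟨h, hbL, h'⟩
          -- The first slope is already below `s`, so no later entry can have slope `s`.
          exact ⟨h, hbL, fun a ha => (h' a ha).resolve_left
            ((h.1 a ha).trans (hs _ hbL)).ne⟩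
        · rintro ⟨h, hbL, h'⟩
          exact ⟨h, hbL, fun a ha => .inr (h' a ha)⟩

/-- If `H` vanishes off the slopes in `L`, the ordered product of its slope factors is the
generating series of `s_θ * H`. -/
theorem coeff_prod_slopeFactor (θ : Fin r → ℝ) (H : DimVec r → R) {L : List ℝ}
    (hL : L.Pairwise (· > ·)) (hH : ∀ b, slope θ b ∉ L → H b = 0) (β : DimVec r) :
    MvPowerSeries.coeff (Finsupp.equivFunOnFinite.symm β.1) (L.map (slopeFactor θ H)).prod =
      act (hnCol θ) H β := by
  classical
  rw [prod_slopeFactor θ H hL, coeff_genSeries_eq_act, act, act]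
  refine Finset.sum_congr rfl fun α _ => ?_
  by_cases h : ∀ a ∈ α, slope θ a ∈ L
  · rw [hnColIn, hnCol]
    congr 1
    exact if_congr (and_iff_left h) rfl rfl
  · push Not at h
    obtain ⟨a, ha, haL⟩ := h
    rw [List.prod_eq_zero (List.mem_map.mpr ⟨a, ha, hH a haL⟩), smul_zero, smul_zero]

/-! ### Powers and the logarithm -/

open Classical in
theorem classSeries_pow (p : DimVec r → Prop) (H : DimVec r → R) (n : ℕ) :
    classSeries p H ^ n =
      genSeries (fun α => if α.length = n ∧ ∀ a ∈ α, p a then 1 else 0) H := by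
  induction n with
  | zero =>
    rw [pow_zero, ← genSeries_nil H]
    congr 1
    funext α
    cases α <;> simp
  | succ n ih =>
    rw [pow_succ', ih, classSeries_mul_genSeries]
    congr 1
    funext α
    cases α with
    | nil => simp [consCol]
    | cons b α => by_cases hb : p b <;> simp [consCol, hb]

theorem sum_mul_total (θ : Fin r → ℝ) {s : ℝ} {α : List (DimVec r)}
    (h : ∀ a ∈ α, slope θ a = s) :
    ∑ k, θ k * (total α k : ℝ) = s * ∑ k, (total α k : ℝ) := by
  induction α with
  | nil => simp [total]
  | cons b α ih =>
    have hb : (b.size : ℝ) ≠ 0 := by exact_mod_cast b.size_pos.ne'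
    have h1 : ∑ k, θ k * (b.1 k : ℝ) = s * ∑ k, (b.1 k : ℝ) := by
      rw [← h b List.mem_cons_self, slope]
      have : ∑ k, (b.1 k : ℝ) = b.size := by simp [size]
      rw [this, div_mul_cancel₀ _ hb]
    have h2 := ih fun a ha => h a (List.mem_cons_of_mem _ ha)
    simp only [total_cons, Pi.add_apply, Nat.cast_add, mul_add, Finset.sum_add_distrib, h1, h2]

theorem slope_of_mem_decomp {θ : Fin r → ℝ} {s : ℝ} {γ : DimVec r} {α : List (DimVec r)}
    (hα : α ∈ decomp γ) (h : ∀ a ∈ α, slope θ a = s) : slope θ γ = s := by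
  have h1 := sum_mul_total θ h
  rw [mem_decomp.mp hα] at h1
  have h2 : ∑ k, (γ.1 k : ℝ) = γ.size := by simp [size]
  have h3 : (γ.size : ℝ) ≠ 0 := by exact_mod_cast γ.size_pos.ne'
  rw [slope, h1, h2, mul_div_cancel_right₀ _ h3]

/-- A sum of elements of common slope has that slope again, so the common slope can only be that of
`γ`. -/
theorem slope_eq_of_pairwise {θ : Fin r → ℝ} {γ : DimVec r} {α : List (DimVec r)}
    (hα : α ∈ decomp γ) :
    α.Pairwise (fun a b => slope θ a = slope θ b) ↔ ∀ a ∈ α, slope θ a = slope θ γ := by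
  constructor
  · intro h a ha
    have h1 : ∀ b ∈ α, slope θ b = slope θ a := fun b hb => by
      by_cases hab : b = a
      · rw [hab]
      · have : Std.Symm fun a b : DimVec r => slope θ a = slope θ b := ⟨fun _ _ h => h.symm⟩
        exact h.forall hb ha hab
    exact (slope_of_mem_decomp hα h1).symm
  · exact fun h => List.pairwise_of_forall_mem_list fun a ha b hb => (h a ha).trans (h b hb).symm

/-- This is the coefficient at `γ` of `log (1 + f)`. The series can be cut off because a tuple with
total `γ` has at most `γ.size` entries; the index `n` stands for length `n + 1`. -/
theorem act_logCol (θ : Fin r → ℝ) (H : DimVec r → R) (γ : DimVec r) :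
    act (logCol θ) H γ = ∑ n ∈ Finset.range γ.size, ((-1) ^ n / ((n + 1 : ℕ) : ℚ)) •
      MvPowerSeries.coeff (Finsupp.equivFunOnFinite.symm γ.1)
        (classSeries (fun b => slope θ b = slope θ γ) H ^ (n + 1)) := by
  classical
  simp_rw [classSeries_pow, coeff_genSeries_eq_act, act, Finset.smul_sum]
  rw [Finset.sum_comm]
  refine Finset.sum_congr rfl fun α hα => ?_
  simp_rw [smul_smul, ← Finset.sum_smul]
  congr 1
  have h1 : α ≠ [] := by
    rintro rfl
    exact γ.2 ((mem_decomp.mp hα).symm.trans (by simp [total]))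
  obtain ⟨m, hm⟩ := Nat.exists_eq_succ_of_ne_zero (mt List.length_eq_zero_iff.mp h1)
  have h2 := length_le α
  rw [sum_size_of_mem_decomp hα] at h2
  rw [logCol, if_congr (slope_eq_of_pairwise hα) rfl rfl]
  by_cases h : ∀ a ∈ α, slope θ a = slope θ γ
  · rw [if_pos h, Finset.sum_eq_single_of_mem m (Finset.mem_range.mpr (by omega))]
    · rw [if_pos ⟨hm, h⟩, hm]
      simp
    · intro n _ hn
      rw [if_neg fun h' => hn (Nat.succ_injective (h'.1.symm.trans hm)), mul_zero]
  · rw [if_neg h, eq_comm]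
    refine Finset.sum_eq_zero fun n _ => ?_
    rw [if_neg fun h' => h h'.2, mul_zero]

theorem coeff_classSeries_pow_of_slope_ne {θ : Fin r → ℝ} (H : DimVec r → R) {s : ℝ}
    {γ : DimVec r} (hs : slope θ γ ≠ s) (n : ℕ) :
    MvPowerSeries.coeff (Finsupp.equivFunOnFinite.symm γ.1)
      (classSeries (fun b => slope θ b = s) H ^ n) = 0 := by
  classical
  rw [classSeries_pow, coeff_genSeries_eq_act, act]
  refine Finset.sum_eq_zero fun α hα => ?_
  rw [if_neg fun h => hs (slope_of_mem_decomp hα h.2), zero_smul]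

/-! ### Locality -/

theorem act_congr (F : List (DimVec r) → ℚ) {H H' : DimVec r → R} {γ : DimVec r}
    (h : ∀ b : DimVec r, b.1 ≤ γ.1 → H b = H' b) : act F H γ = act F H' γ := by
  refine Finset.sum_congr rfl fun α hα => ?_
  rw [List.map_congr_left fun a ha => h a ((le_total ha).trans_eq (mem_decomp.mp hα))]

theorem stackyDT_eq (A : DimVec r → R) (θ : Fin r → ℝ) (γ : DimVec r) :
    stackyDT A θ γ = A γ - ∑ α ∈ (decomp γ).filter (fun α => 2 ≤ α.length),
      hnCol θ α • (α.map (stackyDT A θ)).prod := by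
  have h := congrFun (hnCol_act_stackyDT A θ) γ
  rw [act_hnCol_eq] at h
  exact eq_sub_of_add_eq h

theorem size_induction {P : DimVec r → Prop}
    (h : ∀ γ, (∀ b : DimVec r, b.size < γ.size → P b) → P γ) (γ : DimVec r) : P γ :=
  (measure (size (r := r))).wf.induction γ h

/-- The recursion at `γ` only involves summands of `γ`; this justifies truncating to elements `≤ γ`.
-/
theorem stackyDT_congr {A A' : DimVec r → R} (θ : Fin r → ℝ) (γ : DimVec r)
    (h : ∀ b : DimVec r, b.1 ≤ γ.1 → A b = A' b) : stackyDT A θ γ = stackyDT A' θ γ := by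
  induction γ using size_induction with
  | h γ ih =>
    rw [stackyDT_eq, stackyDT_eq, h γ le_rfl]
    congr 1
    refine Finset.sum_congr rfl fun α hα => ?_
    obtain ⟨h1, h2⟩ := Finset.mem_filter.mp hα
    rw [List.map_congr_left fun a ha => ih a (size_lt_of_mem h1 h2 ha) fun b hb =>
      h b (hb.trans ((le_total ha).trans_eq (mem_decomp.mp h1)))]

theorem stackyDT_mem (𝓡 : (Fin r → ℕ) → Submodule ℚ R) [SetLike.GradedMonoid 𝓡]
    {A : DimVec r → R} (hA : ∀ β : DimVec r, A β ∈ 𝓡 β.1) (θ : Fin r → ℝ) (γ : DimVec r) :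
    stackyDT A θ γ ∈ 𝓡 γ.1 := by
  induction γ using size_induction with
  | h γ ih =>
    rw [stackyDT_eq]
    refine Submodule.sub_mem _ (hA γ) (Submodule.sum_mem _ fun α hα => Submodule.smul_mem _ _ ?_)
    obtain ⟨h1, h2⟩ := Finset.mem_filter.mp hα
    rw [← mem_decomp.mp h1, total]
    exact SetLike.list_prod_map_mem_graded α Subtype.val _ fun a ha =>
      ih a (size_lt_of_mem h1 h2 ha)

/-! ### Logarithmic derivatives of power series -/

section LogDeriv

variable {σ R : Type*} [Ring R]

/-- The Euler derivation, which multiplies a series of degree `n` by `n`. -/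
noncomputable def eulerDeriv (f : MvPowerSeries σ R) : MvPowerSeries σ R :=
  fun a => a.degree • f a

theorem coeff_eulerDeriv (a : σ →₀ ℕ) (f : MvPowerSeries σ R) :
    MvPowerSeries.coeff a (eulerDeriv f) = a.degree • MvPowerSeries.coeff a f := rfl

theorem eulerDeriv_mul (f g : MvPowerSeries σ R) :
    eulerDeriv (f * g) = eulerDeriv f * g + f * eulerDeriv g := by
  classical
  ext a
  simp only [map_add, coeff_eulerDeriv, MvPowerSeries.coeff_mul, Finset.smul_sum,
    ← Finset.sum_add_distrib]
  refine Finset.sum_congr rfl fun x hx => ?_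
  rw [← Finset.HasAntidiagonal.mem_antidiagonal.mp hx, map_add, add_smul, smul_mul_assoc, mul_smul_comm]

theorem eulerDeriv_one_add (f : MvPowerSeries σ R) : eulerDeriv (1 + f) = eulerDeriv f := by
  classical
  ext a
  rw [coeff_eulerDeriv, coeff_eulerDeriv, map_add, MvPowerSeries.coeff_one]
  split_ifs with h
  · simp [h]
  · rw [zero_add]

theorem eulerDeriv_one : eulerDeriv (1 : MvPowerSeries σ R) = 0 := by
  rw [← add_zero (1 : MvPowerSeries σ R), eulerDeriv_one_add]
  ext a
  simp [coeff_eulerDeriv]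

/-- The logarithmic derivative `x⁻¹ D(x)` of a series with constant coefficient `1`. -/
noncomputable def logDeriv (x : MvPowerSeries σ R) : MvPowerSeries σ R :=
  MvPowerSeries.invOfUnit x 1 * eulerDeriv x

theorem invOfUnit_one_mul {x y : MvPowerSeries σ R} (hx : MvPowerSeries.constantCoeff x = 1)
    (hy : MvPowerSeries.constantCoeff y = 1) :
    MvPowerSeries.invOfUnit (x * y) 1 =
      MvPowerSeries.invOfUnit y 1 * MvPowerSeries.invOfUnit x 1 := by
  have hxy : MvPowerSeries.constantCoeff (x * y) = 1 := by rw [map_mul, hx, hy, one_mul]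
  refine left_inv_eq_right_inv (MvPowerSeries.invOfUnit_mul _ 1 hxy) ?_
  rw [mul_assoc, ← mul_assoc y, MvPowerSeries.mul_invOfUnit y 1 hy, one_mul,
    MvPowerSeries.mul_invOfUnit x 1 hx]

variable {B : Subring (MvPowerSeries σ R)} {c : σ →₀ ℕ}

/-- Leibniz gives `(xy)⁻¹ D(xy) = y⁻¹ (x⁻¹ D(x)) y + y⁻¹ D(y)`. The hypothesis `htr` makes the
coefficient at `c` a trace on `B`, which removes the conjugation by `y`. -/
theorem coeff_logDeriv_mul
    (hD : ∀ f ∈ B, eulerDeriv f ∈ B)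
    (htr : ∀ f ∈ B, ∀ g ∈ B, MvPowerSeries.coeff c (f * g) = MvPowerSeries.coeff c (g * f))
    {x y : MvPowerSeries σ R} (hx : x ∈ B) (hy : y ∈ B)
    (hx1 : MvPowerSeries.constantCoeff x = 1) (hy1 : MvPowerSeries.constantCoeff y = 1)
    (hx' : MvPowerSeries.invOfUnit x 1 ∈ B) (hy' : MvPowerSeries.invOfUnit y 1 ∈ B) :
    MvPowerSeries.coeff c (logDeriv (x * y)) =
      MvPowerSeries.coeff c (logDeriv x) + MvPowerSeries.coeff c (logDeriv y) := by
  have h1 : logDeriv (x * y) =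
      MvPowerSeries.invOfUnit y 1 * (logDeriv x * y) + logDeriv y := by
    have h := MvPowerSeries.invOfUnit_mul x 1 hx1
    simp only [logDeriv, invOfUnit_one_mul hx1 hy1, eulerDeriv_mul, mul_add, mul_assoc]
    rw [← mul_assoc _ x, h, one_mul]
  rw [h1, map_add, htr _ hy' (logDeriv x * y) (B.mul_mem (B.mul_mem hx' (hD x hx)) hy), mul_assoc,
    MvPowerSeries.mul_invOfUnit y 1 hy1, mul_one]

theorem coeff_logDeriv_list_prod
    (hD : ∀ f ∈ B, eulerDeriv f ∈ B)
    (htr : ∀ f ∈ B, ∀ g ∈ B, MvPowerSeries.coeff c (f * g) = MvPowerSeries.coeff c (g * f))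
    {l : List (MvPowerSeries σ R)}
    (h : ∀ x ∈ l, x ∈ B ∧ MvPowerSeries.constantCoeff x = 1)
    (hinv : ∀ x ∈ B, MvPowerSeries.constantCoeff x = 1 → MvPowerSeries.invOfUnit x 1 ∈ B) :
    MvPowerSeries.coeff c (logDeriv l.prod) =
      (l.map fun x => MvPowerSeries.coeff c (logDeriv x)).sum := by
  induction l with
  | nil => simp [logDeriv, eulerDeriv_one]
  | cons x l ih =>
    obtain ⟨⟨hx, hx1⟩, hl⟩ := List.forall_mem_cons.mp h
    have hp : l.prod ∈ B := B.list_prod_mem fun y hy => (hl y hy).1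
    have hp1 : MvPowerSeries.constantCoeff l.prod = 1 := by
      rw [map_list_prod]
      exact List.prod_eq_one fun y hy => by
        obtain ⟨z, hz, rfl⟩ := List.mem_map.mp hy
        exact (hl z hz).2
    rw [List.prod_cons, List.map_cons, List.sum_cons, ← ih hl]
    exact coeff_logDeriv_mul hD htr hx hp hx1 hp1 (hinv x hx hx1) (hinv _ hp hp1)

/-- The trace rotates every Leibniz term `f^i D(f) f^j` into the same form. The extra factor `f ^ m`
absorbs the rotated copies of `f` in the induction. -/
theorem coeff_pow_mul_eulerDeriv_pow
    (hD : ∀ f ∈ B, eulerDeriv f ∈ B)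
    (htr : ∀ f ∈ B, ∀ g ∈ B, MvPowerSeries.coeff c (f * g) = MvPowerSeries.coeff c (g * f))
    {f : MvPowerSeries σ R} (hf : f ∈ B) (m n : ℕ) :
    MvPowerSeries.coeff c (f ^ m * eulerDeriv (f ^ (n + 1))) =
      (n + 1) • MvPowerSeries.coeff c (f ^ (m + n) * eulerDeriv f) := by
  induction n generalizing m with
  | zero => simp
  | succ n ih =>
    have h : f ^ (m + 1) * eulerDeriv (f ^ (n + 1)) =
        f * (f ^ m * eulerDeriv (f ^ (n + 1))) := by rw [pow_succ', mul_assoc]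
    rw [pow_succ f (n + 1), eulerDeriv_mul, mul_add, map_add, ← mul_assoc, ← mul_assoc, ← pow_add,
      ← htr f hf _ (B.mul_mem (B.pow_mem hf m) (hD _ (B.pow_mem hf _))), ← h, ih (m + 1),
      add_smul (n + 1) 1, one_smul, show m + 1 + n = m + (n + 1) by ring]

/-- The degree `c` part of `D(log (1 + f))` is that of the logarithmic derivative of `1 + f`. -/
theorem degree_smul_coeff_log [Algebra ℚ R]
    (hD : ∀ f ∈ B, eulerDeriv f ∈ B)
    (htr : ∀ f ∈ B, ∀ g ∈ B, MvPowerSeries.coeff c (f * g) = MvPowerSeries.coeff c (g * f))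
    {f : MvPowerSeries σ R} (hf : f ∈ B)
    (hf0 : MvPowerSeries.constantCoeff f = 0) :
    c.degree • ∑ n ∈ Finset.range c.degree, ((-1) ^ n / ((n + 1 : ℕ) : ℚ)) •
      MvPowerSeries.coeff c (f ^ (n + 1)) = MvPowerSeries.coeff c (logDeriv (1 + f)) := by
  have h1 : MvPowerSeries.constantCoeff (1 + f) = 1 := by rw [map_add, hf0, map_one, add_zero]
  -- A finite geometric sum for `(1 + f)⁻¹`, with an explicit remainder.
  have h2 : ∑ n ∈ Finset.range c.degree, (-f) ^ n = MvPowerSeries.invOfUnit (1 + f) 1 -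
      MvPowerSeries.invOfUnit (1 + f) 1 * (-f) ^ c.degree := by
    have h := mul_neg_geom_sum (-f) c.degree
    rw [sub_neg_eq_add] at h
    rw [← mul_one_sub, ← h, ← mul_assoc, MvPowerSeries.invOfUnit_mul _ 1 h1, one_mul]
  -- The remainder has order at least `c.degree`, and `D(f)` has no constant term, so their product
  -- starts beyond degree `c.degree`.
  have h3 : MvPowerSeries.coeff c
      (MvPowerSeries.invOfUnit (1 + f) 1 * (-f) ^ c.degree * eulerDeriv f) = 0 := by
    refine MvPowerSeries.coeff_of_lt_order ?_
    have h4 : (c.degree : ℕ∞) ≤ ((-f) ^ c.degree).order :=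
      MvPowerSeries.le_order_pow_of_constantCoeff_eq_zero _ (by rw [map_neg, hf0, neg_zero])
    have h5 : 1 ≤ (eulerDeriv f).order := by
      rw [MvPowerSeries.one_le_order_iff_constCoeff_eq_zero,
        ← MvPowerSeries.coeff_zero_eq_constantCoeff_apply, coeff_eulerDeriv]
      simp
    calc (c.degree : ℕ∞) < c.degree + 1 := by exact_mod_cast Nat.lt_succ_self _
      _ ≤ ((-f) ^ c.degree).order + (eulerDeriv f).order := add_le_add h4 h5
      _ ≤ (MvPowerSeries.invOfUnit (1 + f) 1 * (-f) ^ c.degree).order + (eulerDeriv f).order := by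
        gcongr
        exact le_add_self.trans MvPowerSeries.le_order_mul
      _ ≤ _ := MvPowerSeries.le_order_mul
  have h6 : MvPowerSeries.coeff c (logDeriv (1 + f)) =
      ∑ n ∈ Finset.range c.degree, MvPowerSeries.coeff c ((-f) ^ n * eulerDeriv f) := by
    rw [← map_sum, ← Finset.sum_mul, h2, sub_mul, map_sub, h3, sub_zero, logDeriv,
      eulerDeriv_one_add]
  rw [h6, Finset.smul_sum]
  refine Finset.sum_congr rfl fun n _ => ?_
  -- The factor `n + 1` produced by differentiating `f ^ (n + 1)` cancels the denominator in the
  -- logarithm.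
  have h7 := coeff_pow_mul_eulerDeriv_pow hD htr hf 0 n
  rw [pow_zero, one_mul, zero_add, coeff_eulerDeriv] at h7
  have h8 : ((n + 1 : ℕ) : ℚ) ≠ 0 := by positivity
  rw [smul_comm, h7, ← Nat.cast_smul_eq_nsmul ℚ, smul_smul, div_mul_cancel₀ _ h8, neg_pow f,
    mul_assoc]
  rcases neg_one_pow_eq_or ℚ n with h | h <;>
    rcases Nat.even_or_odd n with h' | h' <;> simp [h'.neg_one_pow]

end LogDeriv

/-! ### Homogeneous series -/

section Homogeneous

variable {r : ℕ} {R : Type*} [Ring R] [Algebra ℚ R] (𝓡 : (Fin r → ℕ) → Submodule ℚ R)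

/-- The series whose coefficients are homogeneous of the corresponding degree. -/
def homogeneousSeries [SetLike.GradedMonoid 𝓡] : Subring (MvPowerSeries (Fin r) R) where
  carrier := {f | ∀ a : Fin r →₀ ℕ, MvPowerSeries.coeff a f ∈ 𝓡 ⇑a}
  mul_mem' {f g} hf hg a := by
    classical
    rw [MvPowerSeries.coeff_mul]
    refine Submodule.sum_mem _ fun x hx => ?_
    rw [← Finset.HasAntidiagonal.mem_antidiagonal.mp hx]
    exact SetLike.mul_mem_graded (hf x.1) (hg x.2)
  one_mem' a := by
    classical
    rw [MvPowerSeries.coeff_one]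
    split_ifs with h
    · rw [h]
      exact SetLike.one_mem_graded 𝓡
    · exact Submodule.zero_mem _
  add_mem' hf hg a := Submodule.add_mem _ (hf a) (hg a)
  zero_mem' _ := Submodule.zero_mem _
  neg_mem' hf a := Submodule.neg_mem _ (hf a)

open Classical in
/-- The part of a grading with degrees in a submonoid. -/
noncomputable def restrictGrading (P : AddSubmonoid (Fin r → ℕ)) (a : Fin r → ℕ) :
    Submodule ℚ R :=
  if a ∈ P then 𝓡 a else ⊥

instance restrictGrading.gradedMonoid (P : AddSubmonoid (Fin r → ℕ)) [SetLike.GradedMonoid 𝓡] :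
    SetLike.GradedMonoid (restrictGrading 𝓡 P) where
  one_mem := by
    rw [restrictGrading, if_pos P.zero_mem]
    exact SetLike.one_mem_graded 𝓡
  mul_mem i j x y hx hy := by
    rw [restrictGrading] at hx hy ⊢
    split_ifs at hx hy with hi hj hj
    · rw [if_pos (P.add_mem hi hj)]
      exact SetLike.mul_mem_graded hx hy
    · rw [(Submodule.mem_bot ℚ).mp hy, mul_zero]
      exact Submodule.zero_mem _
    all_goals
      rw [(Submodule.mem_bot ℚ).mp hx, zero_mul]
      exact Submodule.zero_mem _

variable {𝓡}

theorem restrictGrading_of_mem {P : AddSubmonoid (Fin r → ℕ)} {a : Fin r → ℕ} (h : a ∈ P) :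
    restrictGrading 𝓡 P a = 𝓡 a :=
  if_pos h

theorem eq_zero_of_mem_restrictGrading {P : AddSubmonoid (Fin r → ℕ)} {a : Fin r → ℕ} {x : R}
    (hx : x ∈ restrictGrading 𝓡 P a) (h : a ∉ P) : x = 0 := by
  rwa [restrictGrading, if_neg h, Submodule.mem_bot] at hx

variable [SetLike.GradedMonoid 𝓡]

theorem eulerDeriv_mem {f : MvPowerSeries (Fin r) R} (hf : f ∈ homogeneousSeries 𝓡) :
    eulerDeriv f ∈ homogeneousSeries 𝓡 := fun a => (𝓡 ⇑a).smul_of_tower_mem a.degree (hf a)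

/-- The recursion for the coefficients of the inverse preserves degrees. -/
theorem invOfUnit_mem {f : MvPowerSeries (Fin r) R} (hf : f ∈ homogeneousSeries 𝓡) :
    MvPowerSeries.invOfUnit f 1 ∈ homogeneousSeries 𝓡 := by
  classical
  intro a
  induction a using WellFoundedLT.induction with
  | ind a ih =>
    rw [MvPowerSeries.coeff_invOfUnit]
    simp only [inv_one, Units.val_one, neg_mul, one_mul]
    split_ifs with h
    · rw [h]
      exact SetLike.one_mem_graded 𝓡
    · refine Submodule.neg_mem _ (Submodule.sum_mem _ fun x hx => ?_)
      split_ifs with hlt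
      · rw [← Finset.HasAntidiagonal.mem_antidiagonal.mp hx]
        exact SetLike.mul_mem_graded (hf x.1) (ih x.2 hlt)
      · exact Submodule.zero_mem _

theorem slopeFactor_mem {θ : Fin r → ℝ} {H : DimVec r → R} {s : ℝ}
    (h : ∀ b : DimVec r, slope θ b = s → H b ∈ 𝓡 b.1) :
    slopeFactor θ H s ∈ homogeneousSeries 𝓡 := by
  classical
  refine Subring.add_mem _ (Subring.one_mem _) fun a => ?_
  induction a using exponent_cases with
  | h0 =>
    rw [coeff_zero_classSeries]
    exact Submodule.zero_mem _
  | h γ =>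
    rw [coeff_classSeries]
    split_ifs with hs
    · exact h γ hs
    · exact Submodule.zero_mem _

end Homogeneous

/-! ### Refinement of stabilities -/

variable {r : ℕ}

/-- `θ'` refines the weak stability `θ` on the elements `≤ γ` of `S`. -/
def RefinesBelow (θ θ' : Fin r → ℝ) (γ : DimVec r) : Prop :=
  ∀ a b : DimVec r, a.1 ≤ γ.1 → b.1 ≤ γ.1 → slope θ b < slope θ a → slope θ' b < slope θ' a

theorem RefinesBelow.slope_eq {θ θ' : Fin r → ℝ} {γ a b : DimVec r} (h : RefinesBelow θ θ' γ)
    (ha : a.1 ≤ γ.1) (hb : b.1 ≤ γ.1) (hab : slope θ' a = slope θ' b) : slope θ a = slope θ b :=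
  le_antisymm (not_lt.mp fun hlt => (h a b ha hb hlt).ne' hab)
    (not_lt.mp fun hlt => (h b a hb ha hlt).ne hab)

theorem finite_le (γ : DimVec r) : {b : DimVec r | b.1 ≤ γ.1}.Finite :=
  Set.Finite.preimage (f := Subtype.val) Subtype.val_injective.injOn (Set.finite_Iic γ.1)

/-- Slopes are continuous in the stability, and only finitely many strict inequalities have to
persist. -/
theorem eventually_refinesBelow (θ : Fin r → ℝ) (γ : DimVec r) :
    ∀ᶠ θ' in 𝓝 θ, RefinesBelow θ θ' γ := by
  have hcont : ∀ a : DimVec r, Continuous fun θ : Fin r → ℝ => slope θ a := by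
    intro a
    unfold slope
    fun_prop
  have h : ∀ᶠ θ' in 𝓝 θ, ∀ a ∈ {b : DimVec r | b.1 ≤ γ.1}, ∀ b ∈ {b : DimVec r | b.1 ≤ γ.1},
      slope θ b < slope θ a → slope θ' b < slope θ' a := by
    rw [eventually_all_finite (finite_le γ)]
    intro a _
    rw [eventually_all_finite (finite_le γ)]
    intro b _
    rw [eventually_imp_distrib_left]
    exact fun hab => (hcont b).continuousAt.eventually_lt (hcont a).continuousAt hab
  filter_upwards [h] with θ' h a b ha hb
  exact h a ha b hb

/-- The degrees of slope `s`, together with zero. -/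
def slopeSubmonoid (θ : Fin r → ℝ) (s : ℝ) : AddSubmonoid (Fin r → ℕ) where
  carrier := {a | ∑ k, θ k * (a k : ℝ) = s * ∑ k, (a k : ℝ)}
  zero_mem' := by simp
  add_mem' {a b} ha hb := by
    simp only [Set.mem_ofPred_eq, Pi.add_apply, Nat.cast_add, mul_add,
      Finset.sum_add_distrib] at ha hb ⊢
    rw [ha, hb]

theorem mem_slopeSubmonoid {θ : Fin r → ℝ} {s : ℝ} {b : DimVec r} :
    b.1 ∈ slopeSubmonoid θ s ↔ slope θ b = s := by
  have hb : (b.size : ℝ) ≠ 0 := by exact_mod_cast b.size_pos.ne'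
  rw [slope, div_eq_iff hb, size, Nat.cast_sum]
  rfl

/-- The elements `≤ γ` of `S`. -/
noncomputable def below (γ : DimVec r) : Finset (DimVec r) := (finite_le γ).toFinset

theorem mem_below {γ b : DimVec r} : b ∈ below γ ↔ b.1 ≤ γ.1 := by simp [below]

/-- The slopes of the elements `≤ γ`, in decreasing order. -/
noncomputable def slopesBelow (θ : Fin r → ℝ) (γ : DimVec r) : List ℝ :=
  ((below γ).image (slope θ)).sort (· ≥ ·)

open Classical in
/-- The `θ'`-slopes of the elements `≤ γ` with `θ`-slope `s`, in decreasing order. -/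
noncomputable def refinedSlopes (θ θ' : Fin r → ℝ) (γ : DimVec r) (s : ℝ) : List ℝ :=
  (((below γ).filter (fun b => slope θ b = s)).image (slope θ')).sort (· ≥ ·)

theorem mem_slopesBelow {θ : Fin r → ℝ} {γ : DimVec r} {s : ℝ} :
    s ∈ slopesBelow θ γ ↔ ∃ b : DimVec r, b.1 ≤ γ.1 ∧ slope θ b = s := by
  simp only [slopesBelow, Finset.mem_sort, Finset.mem_image, mem_below]

theorem mem_refinedSlopes {θ θ' : Fin r → ℝ} {γ : DimVec r} {s t : ℝ} :
    t ∈ refinedSlopes θ θ' γ s ↔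
      ∃ b : DimVec r, (b.1 ≤ γ.1 ∧ slope θ b = s) ∧ slope θ' b = t := by
  simp only [refinedSlopes, Finset.mem_sort, Finset.mem_image, Finset.mem_filter, mem_below]

theorem pairwise_slopesBelow (θ : Fin r → ℝ) (γ : DimVec r) :
    (slopesBelow θ γ).Pairwise (· > ·) :=
  (Finset.sortedGT_sort _).pairwise

theorem pairwise_refinedSlopes (θ θ' : Fin r → ℝ) (γ : DimVec r) (s : ℝ) :
    (refinedSlopes θ θ' γ s).Pairwise (· > ·) :=
  (Finset.sortedGT_sort _).pairwise

theorem pairwise_flatten_refinedSlopes {θ θ' : Fin r → ℝ} {γ : DimVec r}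
    (h : RefinesBelow θ θ' γ) :
    ((slopesBelow θ γ).map (refinedSlopes θ θ' γ)).flatten.Pairwise (· > ·) := by
  rw [List.pairwise_flatten, List.pairwise_map]
  constructor
  · intro l hl
    obtain ⟨s, -, rfl⟩ := List.mem_map.mp hl
    exact pairwise_refinedSlopes θ θ' γ s
  · refine (pairwise_slopesBelow θ γ).imp fun {s t} hst x hx y hy => ?_
    obtain ⟨a, ⟨ha, rfl⟩, rfl⟩ := mem_refinedSlopes.mp hx
    obtain ⟨b, ⟨hb, rfl⟩, rfl⟩ := mem_refinedSlopes.mp hy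
    exact h a b ha hb hst

variable {R : Type*} [Ring R] [Algebra ℚ R]

open Classical in
/-- The stacky invariants, truncated to the elements `≤ γ`. -/
noncomputable def truncatedDT (A : DimVec r → R) (θ : Fin r → ℝ) (γ b : DimVec r) : R :=
  if b.1 ≤ γ.1 then stackyDT A θ b else 0

/-- The ordered product of the slope factors for `θ'` lying over the `θ`-slope `s`. -/
noncomputable def refinedProd (A : DimVec r → R) (θ θ' : Fin r → ℝ) (γ : DimVec r) (s : ℝ) :
    MvPowerSeries (Fin r) R :=
  ((refinedSlopes θ θ' γ s).map (slopeFactor θ' (truncatedDT A θ' γ))).prod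

/-- The coefficients of the products `refinedProd`. -/
noncomputable def refinedDT (A : DimVec r → R) (θ θ' : Fin r → ℝ) (γ b : DimVec r) : R :=
  MvPowerSeries.coeff (Finsupp.equivFunOnFinite.symm b.1) (refinedProd A θ θ' γ (slope θ b))

theorem coeff_zero_refinedProd (A : DimVec r → R) (θ θ' : Fin r → ℝ) (γ : DimVec r) (s : ℝ) :
    MvPowerSeries.coeff 0 (refinedProd A θ θ' γ s) = 1 := by
  rw [refinedProd, MvPowerSeries.coeff_zero_eq_constantCoeff_apply, map_list_prod, List.map_map]
  refine List.prod_eq_one fun x hx => ?_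
  obtain ⟨t, -, rfl⟩ := List.mem_map.mp hx
  exact coeff_zero_slopeFactor θ' _ t

section Graded

variable (𝓡 : (Fin r → ℕ) → Submodule ℚ R) [SetLike.GradedMonoid 𝓡] {A : DimVec r → R}
  {θ θ' : Fin r → ℝ} {γ : DimVec r}

/-- Below `γ`, equal `θ'`-slopes force equal `θ`-slopes. Truncation is essential: nothing is known
about the refinement on other elements. -/
theorem slopeFactor_truncatedDT_mem (hA : ∀ β : DimVec r, A β ∈ 𝓡 β.1)
    (h : RefinesBelow θ θ' γ) {s t : ℝ} (ht : t ∈ refinedSlopes θ θ' γ s) :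
    slopeFactor θ' (truncatedDT A θ' γ) t ∈
      homogeneousSeries (restrictGrading 𝓡 (slopeSubmonoid θ s)) := by
  refine slopeFactor_mem fun b hb => ?_
  obtain ⟨a, ⟨ha, rfl⟩, rfl⟩ := mem_refinedSlopes.mp ht
  rw [truncatedDT]
  split_ifs with hbγ
  · rw [restrictGrading_of_mem (mem_slopeSubmonoid.mpr (h.slope_eq hbγ ha hb))]
    exact stackyDT_mem 𝓡 hA θ' b
  · exact Submodule.zero_mem _

theorem refinedProd_mem (hA : ∀ β : DimVec r, A β ∈ 𝓡 β.1) (h : RefinesBelow θ θ' γ) (s : ℝ) :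
    refinedProd A θ θ' γ s ∈ homogeneousSeries (restrictGrading 𝓡 (slopeSubmonoid θ s)) := by
  refine Subring.list_prod_mem _ fun x hx => ?_
  obtain ⟨t, ht, rfl⟩ := List.mem_map.mp hx
  exact slopeFactor_truncatedDT_mem 𝓡 hA h ht

theorem slopeFactor_refinedDT (hA : ∀ β : DimVec r, A β ∈ 𝓡 β.1) (h : RefinesBelow θ θ' γ)
    (s : ℝ) : slopeFactor θ (refinedDT A θ θ' γ) s = refinedProd A θ θ' γ s := by
  refine slopeFactor_eq_of_coeff (coeff_zero_refinedProd A θ θ' γ s) (fun β hβ => ?_) ?_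
  · exact eq_zero_of_mem_restrictGrading (refinedProd_mem 𝓡 hA h s _)
      (mt mem_slopeSubmonoid.mp hβ)
  · rintro β rfl
    rfl

/-- Both sides are coefficients of one decreasing product over `θ'`-slopes, on the left bracketed by
`θ`-slope. -/
theorem act_hnCol_refinedDT (hA : ∀ β : DimVec r, A β ∈ 𝓡 β.1) (h : RefinesBelow θ θ' γ) :
    act (hnCol θ) (refinedDT A θ θ' γ) = act (hnCol θ') (truncatedDT A θ' γ) := by
  funext β
  rw [← coeff_prod_slopeFactor θ _ (pairwise_slopesBelow θ γ),
    ← coeff_prod_slopeFactor θ' _ (pairwise_flatten_refinedSlopes h)]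
  · rw [List.map_flatten, List.prod_flatten, List.map_map, List.map_map,
      List.map_congr_left fun s _ => slopeFactor_refinedDT 𝓡 hA h s]
    rfl
  · intro b hb
    rw [truncatedDT, if_neg]
    refine fun hbγ => hb (List.mem_flatten.mpr ⟨_, List.mem_map.mpr
      ⟨slope θ b, mem_slopesBelow.mpr ⟨b, hbγ, rfl⟩, rfl⟩, ?_⟩)
    exact mem_refinedSlopes.mpr ⟨b, ⟨hbγ, rfl⟩, rfl⟩
  · intro b hb
    classical
    -- No element `≤ γ` has this slope, so the product is empty and equals `1`, with zero
    -- coefficient at `b`.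
    have hnil : refinedSlopes θ θ' γ (slope θ b) = [] := by
      refine List.eq_nil_iff_forall_not_mem.mpr fun t ht => hb ?_
      obtain ⟨a, ha, -⟩ := mem_refinedSlopes.mp ht
      exact mem_slopesBelow.mpr ⟨a, ha⟩
    have hb0 : Finsupp.equivFunOnFinite.symm b.1 ≠ 0 := fun h => b.2 (by
      simpa using congrArg (⇑· : (Fin r →₀ ℕ) → Fin r → ℕ) h)
    rw [refinedDT, refinedProd, hnil, List.map_nil, List.prod_nil, MvPowerSeries.coeff_one,
      if_neg hb0]

/-- Refining the Harder-Narasimhan decomposition: `A_θ` is obtained from `A_θ'` by summing over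
the `θ'`-decreasing tuples of equal `θ`-slope. -/
theorem stackyDT_eq_refinedDT (hA : ∀ β : DimVec r, A β ∈ 𝓡 β.1) (h : RefinesBelow θ θ' γ)
    {b : DimVec r} (hb : b.1 ≤ γ.1) : stackyDT A θ b = refinedDT A θ θ' γ b := by
  -- So `refinedDT` consists of the `θ`-invariants of `s_θ' * truncatedDT`, a collection which
  -- agrees with `A` below `γ`.
  rw [stackyDT_unique _ _ θ (act_hnCol_refinedDT 𝓡 hA h)]
  refine stackyDT_congr θ b fun c hc => ?_
  rw [← congrFun (hnCol_act_stackyDT A θ') c]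
  refine act_congr _ fun d hd => ?_
  rw [truncatedDT, if_pos ((hd.trans hc).trans hb)]

end Graded

/-! ### Attractor invariants -/

/-- The Euler derivation multiplies the degree `γ` part of the logarithm by `γ.size`; powers of a
series supported on another slope never reach `γ`. -/
theorem coeff_logDeriv_slopeFactor {B : Subring (MvPowerSeries (Fin r) R)} {γ : DimVec r}
    (hD : ∀ f ∈ B, eulerDeriv f ∈ B)
    (htr : ∀ f ∈ B, ∀ g ∈ B, MvPowerSeries.coeff (Finsupp.equivFunOnFinite.symm γ.1) (f * g) =
      MvPowerSeries.coeff (Finsupp.equivFunOnFinite.symm γ.1) (g * f))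
    {θ : Fin r → ℝ} {H : DimVec r → R} {s : ℝ} (hs : slopeFactor θ H s ∈ B) :
    MvPowerSeries.coeff (Finsupp.equivFunOnFinite.symm γ.1) (logDeriv (slopeFactor θ H s)) =
      if slope θ γ = s then γ.size • act (logCol θ) H γ else 0 := by
  have hf : classSeries (fun b => slope θ b = s) H ∈ B := by
    have := B.sub_mem hs B.one_mem
    rwa [slopeFactor, add_sub_cancel_left] at this
  have hdeg : (Finsupp.equivFunOnFinite.symm γ.1).degree = γ.size :=
    Finsupp.degree_eq_sum _
  have hf0 : MvPowerSeries.constantCoeff (classSeries (fun b => slope θ b = s) H) = 0 :=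
    (MvPowerSeries.coeff_zero_eq_constantCoeff_apply _).symm.trans (coeff_zero_classSeries _ H)
  have h := degree_smul_coeff_log hD htr hf hf0
  rw [slopeFactor, ← h, hdeg]
  split_ifs with hγ
  · rw [act_logCol, hγ]
  · rw [Finset.sum_eq_zero, smul_zero]
    intro n _
    rw [coeff_classSeries_pow_of_slope_ne H hγ, smul_zero]

section SelfStability

variable (ω : (Fin r → ℤ) →ₗ[ℤ] (Fin r → ℤ) →ₗ[ℤ] ℝ)

theorem sum_selfStability_mul (γ : DimVec r) (a : Fin r → ℕ) :
    ∑ k, selfStability ω γ k * (a k : ℝ) = ω (toLattice a) (toLattice γ.1) := by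
  have h : toLattice a = ∑ k, (a k : ℤ) • Pi.single k (1 : ℤ) := by
    funext j
    simp [toLattice, Finset.sum_apply, Pi.single_apply]
  rw [h, map_sum, LinearMap.sum_apply]
  refine Finset.sum_congr rfl fun k _ => ?_
  rw [map_smul, LinearMap.smul_apply, selfStability, zsmul_eq_mul, mul_comm, Int.cast_natCast]

variable {ω}

theorem slope_selfStability (hω : ∀ u v, ω u v = -ω v u) (γ : DimVec r) :
    slope (selfStability ω γ) γ = 0 := by
  rw [slope, sum_selfStability_mul, self_eq_neg.mp (hω _ _), zero_div]

theorem mem_slopeSubmonoid_selfStability {γ : DimVec r} {a : Fin r → ℕ} :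
    a ∈ slopeSubmonoid (selfStability ω γ) 0 ↔ ω (toLattice a) (toLattice γ.1) = 0 := by
  rw [← sum_selfStability_mul]
  change _ = _ ↔ _
  rw [zero_mul]

theorem coeff_mul_comm_of_homogeneous (𝓡 : (Fin r → ℕ) → Submodule ℚ R)
    [SetLike.GradedMonoid 𝓡] (hω : ∀ u v, ω u v = -ω v u)
    (hcomm : ∀ β β' : Fin r → ℕ, ω (toLattice β) (toLattice β') = 0 →
      ∀ x ∈ 𝓡 β, ∀ y ∈ 𝓡 β', x * y = y * x) (γ : DimVec r)
    (f : MvPowerSeries (Fin r) R)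
    (hf : f ∈ homogeneousSeries (restrictGrading 𝓡 (slopeSubmonoid (selfStability ω γ) 0)))
    (g : MvPowerSeries (Fin r) R)
    (hg : g ∈ homogeneousSeries (restrictGrading 𝓡 (slopeSubmonoid (selfStability ω γ) 0))) :
    MvPowerSeries.coeff (Finsupp.equivFunOnFinite.symm γ.1) (f * g) =
      MvPowerSeries.coeff (Finsupp.equivFunOnFinite.symm γ.1) (g * f) := by
  classical
  rw [MvPowerSeries.coeff_mul, MvPowerSeries.coeff_mul]
  refine Finset.sum_equiv (Equiv.prodComm _ _) (by simp [add_comm]) fun x hx => ?_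
  have hfx := hf x.1
  have hgx := hg x.2
  simp only [Equiv.prodComm_apply, Prod.fst_swap, Prod.snd_swap]
  by_cases h2 : ⇑x.1 ∈ slopeSubmonoid (selfStability ω γ) 0
  · by_cases h1 : ⇑x.2 ∈ slopeSubmonoid (selfStability ω γ) 0
    · rw [restrictGrading_of_mem h2] at hfx
      rw [restrictGrading_of_mem h1] at hgx
      refine hcomm _ _ ?_ _ hfx _ hgx
      have hsum : toLattice γ.1 = toLattice ⇑x.1 + toLattice ⇑x.2 := by
        have := Finset.HasAntidiagonal.mem_antidiagonal.mp hx
        funext k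
        have hk := DFunLike.congr_fun this k
        simp only [Finsupp.add_apply, Finsupp.equivFunOnFinite_symm_apply_apply] at hk
        simp [toLattice, ← hk]
      have h := mem_slopeSubmonoid_selfStability.mp h2
      -- With `γ = x.1 + x.2`, the vanishing of `⟨x.1, γ⟩` and `⟨x.1, x.1⟩` leaves `⟨x.1, x.2⟩ = 0`.
      rwa [hsum, map_add, self_eq_neg.mp (hω (toLattice ⇑x.1) (toLattice ⇑x.1)), zero_add] at h
    · rw [eq_zero_of_mem_restrictGrading hgx h1, mul_zero, zero_mul]
  · rw [eq_zero_of_mem_restrictGrading hfx h2, mul_zero, zero_mul]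

/-- The rational invariant of `γ` is unchanged under small perturbations of `⟨-, γ⟩`. -/
theorem rationalDT_eq_of_refinesBelow (𝓡 : (Fin r → ℕ) → Submodule ℚ R)
    [SetLike.GradedMonoid 𝓡] (hω : ∀ u v, ω u v = -ω v u)
    (hcomm : ∀ β β' : Fin r → ℕ, ω (toLattice β) (toLattice β') = 0 →
      ∀ x ∈ 𝓡 β, ∀ y ∈ 𝓡 β', x * y = y * x)
    {A : DimVec r → R} (hA : ∀ β : DimVec r, A β ∈ 𝓡 β.1) {γ : DimVec r} {θ' : Fin r → ℝ}
    (h : RefinesBelow (selfStability ω γ) θ' γ) :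
    rationalDT A θ' γ = rationalDT A (selfStability ω γ) γ := by
  set θ := selfStability ω γ with hθ
  have hγ : slope θ γ = 0 := slope_selfStability hω γ
  have htr := coeff_mul_comm_of_homogeneous 𝓡 hω hcomm γ
  have h1 : rationalDT A θ' γ = act (logCol θ') (truncatedDT A θ' γ) γ :=
    act_congr _ fun b hb => (if_pos hb).symm
  have h2 : rationalDT A θ γ = act (logCol θ) (refinedDT A θ θ' γ) γ :=
    act_congr _ fun b hb => stackyDT_eq_refinedDT 𝓡 hA h hb
  -- The logarithmic derivative of the slope-zero series is evaluated at `γ` twice: directly, and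
  -- through its factorisation over `θ'`-slopes.
  have h3 := coeff_logDeriv_slopeFactor (θ := θ) (H := refinedDT A θ θ' γ) (s := 0)
    (fun _ => eulerDeriv_mem) htr
    (slopeFactor_refinedDT 𝓡 hA h 0 ▸ refinedProd_mem 𝓡 hA h 0)
  rw [if_pos hγ, slopeFactor_refinedDT 𝓡 hA h, refinedProd,
    coeff_logDeriv_list_prod (fun _ => eulerDeriv_mem) htr ?_ fun x hx _ => invOfUnit_mem hx,
    List.map_map, Function.comp_def] at h3
  · rw [List.map_congr_left fun t ht => coeff_logDeriv_slopeFactor (fun _ => eulerDeriv_mem) htr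
      (slopeFactor_truncatedDT_mem 𝓡 hA h ht)] at h3
    have hnodup : (refinedSlopes θ θ' γ 0).Nodup :=
      (pairwise_refinedSlopes θ θ' γ 0).imp fun h => h.ne'
    -- Only the term of slope `slope θ' γ` survives, and it occurs exactly once in the list.
    rw [← List.sum_toFinset _ hnodup, Finset.sum_ite_eq, if_pos, ← h1, ← h2,
      ← Nat.cast_smul_eq_nsmul ℚ, ← Nat.cast_smul_eq_nsmul ℚ] at h3
    · have h4 : (γ.size : ℚ) ≠ 0 := by exact_mod_cast γ.size_pos.ne'
      exact smul_right_injective R h4 h3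
    · exact List.mem_toFinset.mpr (mem_refinedSlopes.mpr ⟨γ, ⟨le_rfl, hγ⟩, rfl⟩)
  · intro x hx
    obtain ⟨t, ht, rfl⟩ := List.mem_map.mp hx
    exact ⟨slopeFactor_truncatedDT_mem 𝓡 hA h ht, coeff_zero_slopeFactor θ' _ t⟩

end SelfStability

end DimVec

theorem mainTheorem4 {r : ℕ} {R : Type*} [Ring R] [Algebra ℚ R]
    (𝓡 : (Fin r → ℕ) → Submodule ℚ R) [GradedAlgebra 𝓡]
    (ω : (Fin r → ℤ) →ₗ[ℤ] (Fin r → ℤ) →ₗ[ℤ] ℝ)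
    (hω : ∀ u v, ω u v = -ω v u)
    (hcomm : ∀ β β' : Fin r → ℕ, ω (DimVec.toLattice β) (DimVec.toLattice β') = 0 →
      ∀ x ∈ 𝓡 β, ∀ y ∈ 𝓡 β', x * y = y * x)
    (A : DimVec r → R) (hA : ∀ β : DimVec r, A β ∈ 𝓡 β.1)
    (γ : DimVec r) :
    DimVec.IsAttractorInvariant A ω γ (DimVec.attractorInvariant A ω γ) ∧
      DimVec.attractorInvariant A ω γ =
        DimVec.rationalDT A (DimVec.selfStability ω γ) γ := by
  have h : DimVec.IsAttractorInvariant A ω γ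
      (DimVec.rationalDT A (DimVec.selfStability ω γ) γ) := by
    filter_upwards [DimVec.eventually_refinesBelow (DimVec.selfStability ω γ) γ] with θ' hθ' _
    exact DimVec.rationalDT_eq_of_refinesBelow 𝓡 hω hcomm hA hθ'
  have hex : ∃ x, DimVec.IsAttractorInvariant A ω γ x := ⟨_, h⟩
  have hx : DimVec.IsAttractorInvariant A ω γ (DimVec.attractorInvariant A ω γ) := by
    rw [DimVec.attractorInvariant, dif_pos hex]
    exact hex.choose_spec
  exact ⟨hx, hx.unique h⟩
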